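/- **Model.** Let $N,M,N_T,N_R,N_c\ge 1$ be integers with $M\le N$ and $N_cN_T\le N$, let $p\in\mathbb Z$, put $N_\theta=N_RN_T$, and let $\xi:\{1,\dots,N\}\to\{0,\dots,N_T-1\}$ be any map. For $s=0,\dots,N_\theta-1$ let $\theta_s=2(s-N_\theta/2)/N_\theta$, and let $d_T=\tfrac12$, $d_R=\tfrac{N_T}{2}$. Define - $\bar\alpha_R\in\mathbb C^{N_R\times N_\theta}$ with entries $(N_RN_T)^{-1/2}e^{2\pi j d_R k\theta_s}$, $0\le k<N_R$, and $\bar\alpha_T(t)=\mathrm{diag}_s\big(e^{2\pi j d_T t\theta_s}\big)\in\mathbb C^{N_\theta\times N_\theta}$; - $\bar A\in\mathbb C^{M\times N}$ with entries $(MN_c)^{-1/2}e^{-2\pi j rn/N}$, $0\le n<M$, $0\le r<N$; - $H_i=\mathrm{diag}\big(e^{2\pi j ipn/M}\big)_{0\le n<M}$ and $D_i=\mathrm{diag}\big(e^{-2\pi j im/N}\big)_{0\le m<N}$. Let $\hat\gamma_1,\dots,\hat\gamma_N,\Phi_1,\dots,\Phi_N$ be mutually independent random variables, where $\hat\gamma_i$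 equals $1$ with probability $N_cN_T/N$ and $0$ otherwise, and $\Phi_i$ is uniform on $[0,2\pi]$. Put $\hat c_i=\hat\gamma_ie^{j\Phi_i}$. The sensing matrix is $$\mathcal A=\sum_{i=1}^N\hat c_i\,\big(\bar\alpha_R\,\bar\alpha_T(\xi(i))\big)\otimes\big(H_i\bar AD_i\big)\in\mathbb C^{N_RM\times N_\theta N}.$$ Write $d=N_RM+N_RN_TN$, let $\|\cdot\|_{op}$ be the operator norm for the Euclidean norms, and let $$\alpha=\Big(\tfrac13\sqrt{\tfrac{1}{N_TN_c}\log d}+\tfrac12\Big)^{-1}.$$ **Lemma.** 1. For every such system, $$P\Big(\|\mathcal A\|_{op}\ge 2\sqrt{\tfrac{N_TN}{M}\log d}\Big)\le\Big(\frac1d\Big)^{\alpha-1},\qquad P\Big(\|\mathcal A\|_{op}\le 2\sqrt{\tfrac{N_TN}{M}\log d}\Big)\ge1-\Big(\frac1d\Big)^{\alpha-1}.$$ 2. For every such system, $\alpha>1$ if and only if $N_cN_T>\tfrac49\log d$. 3. Consequently the bound holds with high probability: for every $\kappa>\tfrac49$ and $\varepsilon>0$ there is $d_0$ such that every such system with $d\ge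 d_0$ and $N_cN_T\ge\kappa\log d$ satisfies $$P\Big(\|\mathcal A\|_{op}\le 2\sqrt{\tfrac{N_TN}{M}\log d}\Big)\ge1-\varepsilon .$$ -/

import Mathlib

open MeasureTheory ProbabilityTheory
open scoped Kronecker Matrix.Norms.L2Operator

/-- Parameters of the compressive MIMO radar: `N` delay bins (and candidate tones), `M` samples per
receiver, `NT` transmitters, `NR` receivers, `Nc` tones per transmitter on average, the integer
frequency-shift factor `p`, and the deterministic rule `xi` that assigns tones to transmitters. -/
structure MIMORadar where
  N : ℕ
  M : ℕ
  NT : ℕ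
  NR : ℕ
  Nc : ℕ
  p : ℤ
  xi : Fin N → Fin NT
  N_pos : 0 < N
  M_pos : 0 < M
  NT_pos : 0 < NT
  NR_pos : 0 < NR
  Nc_pos : 0 < Nc
  /-- There are at most as many samples as delay bins (sub-Nyquist sampling). -/
  M_le_N : M ≤ N
  /-- The selection probability `Nc * NT / N` is at most one. -/
  tones_le : Nc * NT ≤ N

namespace MIMORadar

noncomputable section

variable (S : MIMORadar)

/-- The number of angle bins. -/
abbrev Ntheta : ℕ := S.NR * S.NT

/-- The angle bins `2 v / (NR NT)`, where `v = -NR NT / 2 + s` and `s = 0, …, NR NT - 1`. -/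
def theta (s : Fin S.Ntheta) : ℝ :=
  2 * (-(S.Ntheta : ℝ) / 2 + (s : ℕ)) / S.Ntheta

/-- Transmitter spacing, in carrier wavelengths. -/
def dT : ℝ := 1 / 2

/-- Receiver spacing, in carrier wavelengths. -/
def dR : ℝ := S.NT / 2

/-- The normalized matrix of receiver steering vectors, of size `NR × Ntheta`. -/
def alphaR : Matrix (Fin S.NR) (Fin S.Ntheta) ℂ :=
  Matrix.of fun k s =>
    ((Real.sqrt (1 / ((S.NR : ℝ) * S.NT)) : ℝ) : ℂ) *
      Complex.exp (Complex.I * ((2 * Real.pi * S.dR * (k : ℕ) * S.theta s : ℝ) : ℂ))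

/-- The diagonal matrix of the transmitter steering components, for the transmitter `t`. -/
def alphaT (t : Fin S.NT) : Matrix (Fin S.Ntheta) (Fin S.Ntheta) ℂ :=
  Matrix.diagonal fun s =>
    Complex.exp (Complex.I * ((2 * Real.pi * dT * (t : ℕ) * S.theta s : ℝ) : ℂ))

/-- The matrix of de-chirped tones, of size `M × N`. -/
def Abar : Matrix (Fin S.M) (Fin S.N) ℂ :=
  Matrix.of fun n r =>
    ((1 / Real.sqrt ((S.M : ℝ) * S.Nc) : ℝ) : ℂ) *
      Complex.exp (Complex.I * ((-(2 * Real.pi * ((r : ℕ) * (n : ℕ) / S.N)) : ℝ) : ℂ))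

/-- The frequency shift due to the tone `i`. -/
def H (i : ℕ) : Matrix (Fin S.M) (Fin S.M) ℂ :=
  Matrix.diagonal fun n =>
    Complex.exp (Complex.I * ((2 * Real.pi * (i * S.p * (n : ℕ) / S.M) : ℝ) : ℂ))

/-- The phases of the delay bins due to the tone `i`. -/
def D (i : ℕ) : Matrix (Fin S.N) (Fin S.N) ℂ :=
  Matrix.diagonal fun m =>
    Complex.exp (Complex.I * ((-(2 * Real.pi * (i * (m : ℕ) / S.N)) : ℝ) : ℂ))

/-- The sensing matrix with tone coefficients `c`. The index `i : Fin N` stands for the tone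
`i + 1`, so that the tones are numbered `1, …, N`. -/
def sensingMatrix (c : Fin S.N → ℂ) :
    Matrix (Fin S.NR × Fin S.M) (Fin S.Ntheta × Fin S.N) ℂ :=
  ∑ i : Fin S.N,
    c i • ((S.alphaR * S.alphaT (S.xi i)) ⊗ₖ (S.H ((i : ℕ) + 1) * S.Abar * S.D ((i : ℕ) + 1)))

theorem prob_mem : ((S.Nc : ℝ) * S.NT / S.N) ∈ unitInterval := by
  have hN : (0 : ℝ) < S.N := by exact_mod_cast S.N_pos
  refine ⟨by positivity, ?_⟩
  rw [div_le_one hN]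
  exact_mod_cast S.tones_le

/-- The random selection: indicators `gamma i`, equal to `1` with probability `Nc NT / N` and to `0`
otherwise, and phases `Phi i`, uniform on `[0, 2π]`, all of them mutually independent. -/
structure IsSelection {Ω : Type*} [MeasurableSpace Ω] (P : Measure Ω)
    (gamma Phi : Fin S.N → Ω → ℝ) : Prop where
  measurable_gamma : ∀ i, Measurable (gamma i)
  measurable_Phi : ∀ i, Measurable (Phi i)
  law_gamma : ∀ i, P.map (gamma i) = bernoulliMeasure 1 0 ⟨(S.Nc : ℝ) * S.NT / S.N, S.prob_mem⟩
  law_Phi : ∀ i, pdf.IsUniform (Phi i) (Set.Icc 0 (2 * Real.pi)) P volume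
  indep : iIndepFun (Sum.elim gamma Phi) P

/-- The random sensing matrix, with coefficients `gamma i * exp (I * Phi i)`. -/
def randomMatrix {Ω : Type*} (gamma Phi : Fin S.N → Ω → ℝ) (ω : Ω) :
    Matrix (Fin S.NR × Fin S.M) (Fin S.Ntheta × Fin S.N) ℂ :=
  S.sensingMatrix fun i => (gamma i ω : ℂ) * Complex.exp (Complex.I * (Phi i ω : ℂ))

/-- The sum of the two dimensions of the sensing matrix. -/
def totalDim : ℝ := (S.NR : ℝ) * S.M + (S.NR : ℝ) * S.NT * S.N

/-- The exponent that governs the tail bound. -/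
def alpha : ℝ :=
  1 / (1 / 3 * Real.sqrt (1 / ((S.NT : ℝ) * S.Nc) * Real.log S.totalDim) + 1 / 2)

end

end MIMORadar

/-! ### Trace inequalities: dyadic Hölder, Lie product formula, Golden–Thompson. -/

section GoldenThompson

open Matrix Finset Filter Topology
open scoped ComplexOrder

/-! The sensing matrix is a series `∑ c i • B i` with fixed matrices and independent, centred
coefficients of modulus at most one, so a matrix Bernstein inequality applies. Each `B i` satisfies
`B i * (B i)ᴴ = L ^ 2 • 1` with `L ^ 2 = N / (M Nc)`: the steering rows and the tone rows are
orthogonal characters, and the other factors are diagonal unitaries. The coefficients have second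
moment `q = Nc NT / N`, so the variance is `N q L ^ 2 = NT N / M`. At `t = 2 √(v log d)` the
Bernstein exponent is exactly `-alpha log d`, and the dimensional prefactor `d` turns the bound into
`d ^ (1 - alpha)`.

Bernstein is proved by the Laplace transform method for the Hermitian dilation.
`IsHermitian.trace_exp_add_le` (Golden–Thompson) splits off one summand at a time; a scalar
inequality, carried over by functional calculus, replaces its exponential by `1 + A` plus a multiple
of the identity, and the linear term averages to zero. This peeling adds up the norms of the
individual variances. Nothing is lost here, because every `B i * (B i)ᴴ` is the same multiple of the
identity.

Golden–Thompson follows from `|tr (AB)^(2^k)| ≤ |tr A^(2^k) B^(2^k)|` for Hermitian matrices,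
applied to `exp (A / 2^k)` and `exp (B / 2^k)`, and the Lie product formula. -/

theorem List.prod_map_range_two_mul {α : Type*} [Monoid α] (f : ℕ → α) (p : ℕ) :
    ((List.range (2 * p)).map f).prod
      = ((List.range p).map fun i => f (2 * i) * f (2 * i + 1)).prod := by
  induction p with
  | zero => simp
  | succ p ih =>
    rw [show 2 * (p + 1) = 2 * p + 1 + 1 by ring]
    simp only [List.range_succ, List.map_append, List.prod_append, List.map_cons, List.map_nil,
      List.prod_cons, List.prod_nil, mul_one] at ih ⊢
    rw [ih, mul_assoc]

theorem Finset.prod_range_two_mul {α : Type*} [CommMonoid α] (f : ℕ → α) (p : ℕ) :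
    ∏ i ∈ range (2 * p), f i = ∏ i ∈ range p, (f (2 * i) * f (2 * i + 1)) := by
  induction p with
  | zero => simp
  | succ p ih =>
    rw [show 2 * (p + 1) = 2 * p + 1 + 1 by ring, prod_range_succ, prod_range_succ,
      prod_range_succ, ih, mul_assoc]

theorem Real.hasSum_exp (x : ℝ) : HasSum (fun k : ℕ => x ^ k / (k.factorial : ℝ)) (Real.exp x) := by
  rw [Real.exp_eq_exp_ℝ]
  exact NormedSpace.expSeries_div_hasSum_exp x

namespace Matrix

variable {n : Type*} [Fintype n]

theorem PosSemidef.trace_eq_ofReal_re {A : Matrix n n ℂ} (hA : A.PosSemidef) :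
    A.trace = (A.trace.re : ℂ) := by
  have h := hA.trace_nonneg
  rw [Complex.le_def] at h
  apply Complex.ext <;> simp [← h.2]

theorem PosSemidef.trace_re_nonneg {A : Matrix n n ℂ} (hA : A.PosSemidef) : 0 ≤ A.trace.re := by
  have h := hA.trace_nonneg
  rw [Complex.le_def] at h
  simpa using h.1

variable [DecidableEq n]

/-- The `2 ^ (k + 1)`-th power of the Schatten norm of order `2 ^ (k + 1)`. -/
noncomputable def schattenPow (k : ℕ) (A : Matrix n n ℂ) : ℝ :=
  (((A * Aᴴ) ^ (2 ^ k)).trace).re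

theorem PosSemidef.trace_mul_nonneg {A B : Matrix n n ℂ} (hA : A.PosSemidef)
    (hB : B.PosSemidef) : 0 ≤ (A * B).trace := by
  open scoped MatrixOrder in
  obtain ⟨C, rfl⟩ := CStarAlgebra.nonneg_iff_eq_star_mul_self.mp (nonneg_iff_posSemidef.mpr hB)
  rw [← mul_assoc, trace_mul_comm, ← mul_assoc]
  exact (hA.mul_mul_conjTranspose_same C).trace_nonneg

theorem schattenPow_nonneg (k : ℕ) (A : Matrix n n ℂ) : 0 ≤ schattenPow k A :=
  ((posSemidef_self_mul_conjTranspose A).pow _).trace_re_nonneg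

theorem ofReal_schattenPow (k : ℕ) (A : Matrix n n ℂ) :
    (schattenPow k A : ℂ) = ((A * Aᴴ) ^ (2 ^ k)).trace :=
  ((posSemidef_self_mul_conjTranspose A).pow _).trace_eq_ofReal_re.symm

theorem trace_mul_pow_comm (A B : Matrix n n ℂ) (m : ℕ) :
    ((A * B) ^ m).trace = ((B * A) ^ m).trace := by
  cases m with
  | zero => simp
  | succ m =>
    rw [pow_succ', mul_assoc, trace_mul_comm, mul_assoc, pow_succ]
    congr 1
    have h : SemiconjBy B (A * B) (B * A) := by simp [SemiconjBy, mul_assoc]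
    rw [← mul_assoc, (h.pow_right m).eq, mul_assoc]

/-- Cauchy–Schwarz for the Hilbert–Schmidt inner product: `schattenPow 0` is the squared Frobenius
norm. This is the base case of the dyadic Hölder inequality. -/
theorem norm_trace_mul_sq_le (A B : Matrix n n ℂ) :
    ‖(A * B).trace‖ ^ 2 ≤ schattenPow 0 A * schattenPow 0 B := by
  have key : ∀ C : Matrix n n ℂ, schattenPow 0 C = ∑ x : n × n, ‖C x.1 x.2‖ ^ 2 := by
    intro C
    simp only [schattenPow, pow_zero, pow_one, trace, diag_apply, mul_apply, conjTranspose_apply,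
      Complex.re_sum, Fintype.sum_prod_type]
    refine sum_congr rfl fun i _ => sum_congr rfl fun j _ => ?_
    rw [Complex.star_def, Complex.mul_conj, Complex.ofReal_re, Complex.normSq_eq_norm_sq]
  have h1 : ‖(A * B).trace‖ ≤ ∑ x : n × n, ‖A x.1 x.2‖ * ‖B x.2 x.1‖ := by
    rw [Fintype.sum_prod_type]
    simp only [trace, diag_apply, mul_apply]
    refine (norm_sum_le _ _).trans (sum_le_sum fun i _ => (norm_sum_le _ _).trans ?_)
    exact sum_le_sum fun j _ => (norm_mul _ _).le
  calc ‖(A * B).trace‖ ^ 2 ≤ (∑ x : n × n, ‖A x.1 x.2‖ * ‖B x.2 x.1‖) ^ 2 := by gcongr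
    _ ≤ (∑ x : n × n, ‖A x.1 x.2‖ ^ 2) * ∑ x : n × n, ‖B x.2 x.1‖ ^ 2 :=
      sum_mul_sq_le_sq_mul_sq _ _ _
    _ = _ := by
      rw [key, key]
      congr 1
      exact Fintype.sum_equiv (Equiv.prodComm n n) _ _ fun x => rfl

theorem schattenPow_self_mul_conjTranspose (k : ℕ) (A : Matrix n n ℂ) :
    schattenPow k (A * Aᴴ) = schattenPow (k + 1) A := by
  rw [schattenPow, schattenPow, (isHermitian_mul_conjTranspose_self A).eq, ← pow_two, ← pow_mul,
    pow_succ']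

theorem schattenPow_conjTranspose_mul_self (k : ℕ) (A : Matrix n n ℂ) :
    schattenPow k (Aᴴ * A) = schattenPow (k + 1) A := by
  rw [schattenPow, schattenPow, (isHermitian_conjTranspose_mul_self A).eq, ← pow_two, ← pow_mul,
    pow_succ', trace_mul_pow_comm]

/-- Hölder's inequality for the Schatten norms of order `2 ^ (k + 1)`. -/
theorem norm_trace_prod_pow_le (k : ℕ) (f : ℕ → Matrix n n ℂ) :
    ‖((List.range (2 ^ (k + 1))).map f).prod.trace‖ ^ (2 ^ (k + 1))
      ≤ ∏ i ∈ range (2 ^ (k + 1)), schattenPow k (f i) := by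
  induction k generalizing f with
  | zero =>
    simpa [List.range_succ, prod_range_succ] using norm_trace_mul_sq_le (f 0) (f 1)
  | succ k ih =>
    -- By cyclicity `tr ((AB)(AB)ᴴ)^(2^k) = tr (AᴴA BBᴴ)^(2^k)`, an alternating product of `2^(k+1)`
    -- factors, to which the induction hypothesis applies. The step itself then groups adjacent
    -- factors in pairs.
    have hmul : ∀ A B : Matrix n n ℂ,
        schattenPow k (A * B) ^ 2 ≤ schattenPow (k + 1) A * schattenPow (k + 1) B := by
      intro A B
      have h := ih fun i => if i % 2 = 0 then Aᴴ * A else B * Bᴴ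
      rw [pow_succ' 2 k, List.prod_map_range_two_mul, Finset.prod_range_two_mul] at h
      simp only [Nat.mul_mod_right, if_true, Nat.mul_add_mod, Nat.one_mod, one_ne_zero,
        if_false, List.map_const', List.length_range, List.prod_replicate, prod_const, card_range,
        schattenPow_self_mul_conjTranspose, schattenPow_conjTranspose_mul_self] at h
      rw [pow_mul] at h
      have h2 := (pow_le_pow_iff_left₀ (by positivity) (mul_nonneg (schattenPow_nonneg _ _)
        (schattenPow_nonneg _ _)) (by positivity)).mp h
      refine le_trans (le_of_eq ?_) h2
      have h3 : ((A * B) * (A * B)ᴴ) = A * (B * Bᴴ * Aᴴ) := by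
        simp [conjTranspose_mul, mul_assoc]
      rw [← abs_of_nonneg (schattenPow_nonneg k (A * B)), ← Real.norm_eq_abs,
        ← Complex.norm_real, ofReal_schattenPow, h3, trace_mul_pow_comm A,
        mul_assoc (B * Bᴴ), trace_mul_pow_comm (B * Bᴴ)]
    rw [pow_succ' 2 (k + 1), List.prod_map_range_two_mul, Finset.prod_range_two_mul, mul_comm 2,
      pow_mul]
    calc _ ≤ (∏ i ∈ range (2 ^ (k + 1)), schattenPow k (f (2 * i) * f (2 * i + 1))) ^ 2 := by
          gcongr
          exact ih _
      _ = ∏ i ∈ range (2 ^ (k + 1)), schattenPow k (f (2 * i) * f (2 * i + 1)) ^ 2 :=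
          (prod_pow _ _ _).symm
      _ ≤ _ := prod_le_prod (fun _ _ => sq_nonneg _) fun _ _ => hmul _ _

theorem norm_trace_pow_le_schattenPow (k : ℕ) (A : Matrix n n ℂ) :
    ‖(A ^ (2 ^ (k + 1))).trace‖ ≤ schattenPow k A := by
  have h := norm_trace_prod_pow_le k fun _ => A
  simp only [List.map_const', List.length_range, List.prod_replicate, prod_const, card_range] at h
  exact (pow_le_pow_iff_left₀ (by positivity) (schattenPow_nonneg _ _) (by positivity)).mp h

/-- The Schatten bound for `AB` and cyclicity turn `(AB)^(2^(k+1))` into `(A²B²)^(2^k)` under the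
trace; induct with the squares in place of `A` and `B`. -/
theorem IsHermitian.norm_trace_mul_pow_le {A B : Matrix n n ℂ} (hA : A.IsHermitian)
    (hB : B.IsHermitian) (k : ℕ) :
    ‖((A * B) ^ (2 ^ k)).trace‖ ≤ ‖(A ^ (2 ^ k) * B ^ (2 ^ k)).trace‖ := by
  induction k generalizing A B with
  | zero => simp
  | succ k ih =>
    calc ‖((A * B) ^ (2 ^ (k + 1))).trace‖ ≤ schattenPow k (A * B) :=
          norm_trace_pow_le_schattenPow k _
      _ = ‖((A ^ 2 * B ^ 2) ^ (2 ^ k)).trace‖ := by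
          rw [← abs_of_nonneg (schattenPow_nonneg k (A * B)), ← Real.norm_eq_abs,
            ← Complex.norm_real, ofReal_schattenPow, conjTranspose_mul, hA.eq, hB.eq, mul_assoc,
            trace_mul_pow_comm A]
          simp only [pow_two, mul_assoc]
          rw [← mul_assoc B B, trace_mul_pow_comm (B * B)]
          simp only [mul_assoc]
      _ ≤ ‖((A ^ 2) ^ (2 ^ k) * (B ^ 2) ^ (2 ^ k)).trace‖ := ih (hA.pow 2) (hB.pow 2)
      _ = _ := by rw [← pow_mul, ← pow_mul, ← pow_succ']

theorem _root_.norm_pow_sub_pow_le_of_le {R : Type*} [NormedRing R] [NormOneClass R] {x y : R}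
    {c : ℝ} (hx : ‖x‖ ≤ c) (hy : ‖y‖ ≤ c) (k : ℕ) :
    ‖x ^ (k + 1) - y ^ (k + 1)‖ ≤ (k + 1) * c ^ k * ‖x - y‖ := by
  have hc : 0 ≤ c := (norm_nonneg _).trans hx
  induction k with
  | zero => simp
  | succ k ih =>
    have h : x ^ (k + 1 + 1) - y ^ (k + 1 + 1)
        = x * (x ^ (k + 1) - y ^ (k + 1)) + (x - y) * y ^ (k + 1) := by
      rw [pow_succ' x, pow_succ' y (k + 1)]
      noncomm_ring
    calc ‖x ^ (k + 1 + 1) - y ^ (k + 1 + 1)‖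
        ≤ ‖x‖ * ‖x ^ (k + 1) - y ^ (k + 1)‖ + ‖x - y‖ * ‖y‖ ^ (k + 1) := by
          rw [h]
          refine (norm_add_le _ _).trans (add_le_add (norm_mul_le _ _) ((norm_mul_le _ _).trans ?_))
          gcongr
          exact norm_pow_le _ _
      _ ≤ c * ((k + 1) * c ^ k * ‖x - y‖) + ‖x - y‖ * c ^ (k + 1) := by gcongr
      _ = _ := by push_cast; ring

theorem _root_.NormedSpace.norm_exp_le {R : Type*} [NormedRing R] [NormOneClass R]
    [NormedAlgebra ℝ R] [CompleteSpace R] (x : R) : ‖NormedSpace.exp x‖ ≤ Real.exp ‖x‖ := by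
  rw [NormedSpace.exp_eq_tsum ℝ]
  refine tsum_of_norm_bounded (Real.hasSum_exp ‖x‖) fun k => ?_
  rw [norm_smul, norm_inv, RCLike.norm_natCast, div_eq_inv_mul]
  gcongr
  exact norm_pow_le _ _

/-- The **Lie product formula**. -/
theorem _root_.NormedSpace.tendsto_exp_mul_exp_pow {R : Type*} [NormedRing R] [NormOneClass R]
    [NormedAlgebra ℝ R] [CompleteSpace R] (x y : R) :
    Tendsto (fun k : ℕ => (NormedSpace.exp ((k : ℝ)⁻¹ • x) * NormedSpace.exp ((k : ℝ)⁻¹ • y)) ^ k)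
      atTop (𝓝 (NormedSpace.exp (x + y))) := by
  -- `F` vanishes to first order at `0`, so `k ‖F (1/k)‖ → 0`; the difference of the `k`-th powers
  -- is at most `k ‖F (1/k)‖` times a constant.
  set F : ℝ → R := fun t => NormedSpace.exp (t • x) * NormedSpace.exp (t • y)
    - NormedSpace.exp (t • (x + y)) with hF
  have hF0 : F 0 = 0 := by simp [hF]
  have hd : HasDerivAt F 0 0 := by
    have h := ((hasDerivAt_exp_smul_const (𝕂 := ℝ) x 0).mul
      (hasDerivAt_exp_smul_const (𝕂 := ℝ) y 0)).sub
      (hasDerivAt_exp_smul_const (𝕂 := ℝ) (x + y) 0)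
    convert! h using 1
    simp
  have hlim : Tendsto (fun k : ℕ => (k : ℝ) * ‖F (k : ℝ)⁻¹‖) atTop (𝓝 0) := by
    have h1 : Tendsto (fun t : ℝ => ‖t⁻¹ • F t‖) (𝓝[≠] 0) (𝓝 0) := by
      have := (hasDerivAt_iff_tendsto_slope_zero.mp hd).norm
      simpa [hF0] using this
    have h2 : Tendsto (fun k : ℕ => (k : ℝ)⁻¹) atTop (𝓝[≠] 0) := by
      refine tendsto_nhdsWithin_iff.mpr ⟨tendsto_inv_atTop_nhds_zero_nat, ?_⟩
      filter_upwards [eventually_gt_atTop 0] with k hk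
      simp [hk.ne']
    refine (h1.comp h2).congr fun k => ?_
    simp [norm_smul]
  rw [tendsto_iff_norm_sub_tendsto_zero]
  refine squeeze_zero' (.of_forall fun _ => norm_nonneg _) ?_
    (by simpa using hlim.const_mul (Real.exp (‖x‖ + ‖y‖)))
  filter_upwards [eventually_gt_atTop 0] with k hk
  obtain ⟨k, rfl⟩ := Nat.exists_eq_succ_of_ne_zero hk.ne'
  set s : ℝ := ((k + 1 : ℕ) : ℝ)⁻¹ with hs
  have hs0 : 0 < s := by positivity
  have hsk : s * ((k + 1 : ℕ) : ℝ) = 1 := inv_mul_cancel₀ (by positivity)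
  have hb1 : ‖NormedSpace.exp (s • x) * NormedSpace.exp (s • y)‖
      ≤ Real.exp (s * (‖x‖ + ‖y‖)) := by
    refine (norm_mul_le _ _).trans ?_
    rw [mul_add, Real.exp_add]
    gcongr <;> refine (NormedSpace.norm_exp_le _).trans_eq ?_ <;>
      rw [norm_smul, Real.norm_of_nonneg hs0.le]
  have hb2 : ‖NormedSpace.exp (s • (x + y))‖ ≤ Real.exp (s * (‖x‖ + ‖y‖)) := by
    refine (NormedSpace.norm_exp_le _).trans ?_
    rw [norm_smul, Real.norm_of_nonneg hs0.le]
    gcongr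
    exact norm_add_le _ _
  have hpow : NormedSpace.exp (x + y) = NormedSpace.exp (s • (x + y)) ^ (k + 1) := by
    have : NormedAlgebra ℚ R := NormedAlgebra.restrictScalars ℚ ℝ R
    rw [← NormedSpace.exp_nsmul, ← Nat.cast_smul_eq_nsmul ℝ, smul_smul, mul_comm, hsk, one_smul]
  calc _ = ‖(NormedSpace.exp (s • x) * NormedSpace.exp (s • y)) ^ (k + 1)
        - NormedSpace.exp (s • (x + y)) ^ (k + 1)‖ := by rw [hpow]
    _ ≤ (k + 1) * Real.exp (s * (‖x‖ + ‖y‖)) ^ k * ‖F s‖ :=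
        norm_pow_sub_pow_le_of_le hb1 hb2 k
    _ ≤ (k + 1) * Real.exp (‖x‖ + ‖y‖) * ‖F s‖ := by
        gcongr
        rw [← Real.exp_nat_mul]
        gcongr
        have : (k : ℝ) * s ≤ 1 := by
          push_cast at hsk
          nlinarith
        have h0 : 0 ≤ ‖x‖ + ‖y‖ := by positivity
        nlinarith
    _ = _ := by push_cast; ring

/-- The exponential of a Hermitian matrix is positive semidefinite. -/
theorem IsHermitian.posSemidef_exp {A : Matrix n n ℂ} (hA : A.IsHermitian) :
    (NormedSpace.exp A).PosSemidef := by
  have h : NormedSpace.exp A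
      = NormedSpace.exp ((2 : ℝ)⁻¹ • A) * (NormedSpace.exp ((2 : ℝ)⁻¹ • A))ᴴ := by
    rw [← exp_conjTranspose, conjTranspose_smul, hA.eq, star_trivial, ← exp_add_of_commute _ _ (Commute.refl _),
      ← add_smul]
    norm_num
  rw [h]
  exact posSemidef_self_mul_conjTranspose _

/-- The **Golden–Thompson inequality**. -/
theorem IsHermitian.trace_exp_add_le {A B : Matrix n n ℂ} (hA : A.IsHermitian)
    (hB : B.IsHermitian) :
    (NormedSpace.exp (A + B)).trace.re
      ≤ (NormedSpace.exp A * NormedSpace.exp B).trace.re := by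
  -- The Lie formula needs `‖1‖ = 1`, hence a nonempty index type.
  rcases isEmpty_or_nonempty n with hn | hn
  · simp [trace]
  have hlim := (((NormedSpace.tendsto_exp_mul_exp_pow A B).comp
    (tendsto_pow_atTop_atTop_of_one_lt (one_lt_two (α := ℕ)))))
  have hlim2 := ((Continuous.matrix_trace continuous_id).tendsto _).comp hlim |>.norm
  have hle : ‖(NormedSpace.exp (A + B)).trace‖
      ≤ ‖(NormedSpace.exp A * NormedSpace.exp B).trace‖ := by
    refine le_of_tendsto hlim2 (.of_forall fun k => ?_)
    have hherm : ∀ {C : Matrix n n ℂ}, C.IsHermitian →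
        (NormedSpace.exp ((((2 ^ k : ℕ) : ℝ))⁻¹ • C)).IsHermitian ∧
          NormedSpace.exp ((((2 ^ k : ℕ) : ℝ))⁻¹ • C) ^ (2 ^ k) = NormedSpace.exp C := by
      intro C hC
      refine ⟨IsHermitian.exp ?_, ?_⟩
      · rw [IsHermitian, conjTranspose_smul, hC.eq, star_trivial]
      · rw [← exp_nsmul, ← Nat.cast_smul_eq_nsmul ℝ, smul_smul,
          mul_inv_cancel₀ (by positivity), one_smul]
    have := (hherm hA).1.norm_trace_mul_pow_le (hherm hB).1 k
    rwa [(hherm hA).2, (hherm hB).2] at this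
  refine (Complex.re_le_norm _).trans (hle.trans_eq ?_)
  -- The trace of a product of two positive semidefinite matrices is real and nonnegative, so its
  -- norm is its real part.
  have h := hA.posSemidef_exp.trace_mul_nonneg hB.posSemidef_exp
  rw [Complex.le_def] at h
  rw [← Complex.abs_re_eq_norm.mpr h.2.symm, abs_of_nonneg (by simpa using h.1)]

end Matrix

end GoldenThompson

/-! ### Exponential remainder bounds and the Hermitian dilation. -/

section Dilation

open Matrix Finset
open scoped ComplexOrder MatrixOrder

theorem Real.hasSum_exp_sub_one_sub (x : ℝ) :
    HasSum (fun k : ℕ => x ^ (k + 2) / ((k + 2).factorial : ℝ)) (Real.exp x - 1 - x) := by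
  have h := (hasSum_nat_add_iff' 2).mpr (Real.hasSum_exp x)
  simpa [sum_range_succ, sub_sub] using h

/-- A Bernstein-type bound for the second-order remainder of the exponential. -/
theorem Real.exp_sub_one_sub_le {x : ℝ} (hx : 0 ≤ x) (hx3 : x < 3) :
    Real.exp x - 1 - x ≤ x ^ 2 / 2 / (1 - x / 3) := by
  have hg : HasSum (fun k : ℕ => x ^ 2 / 2 * (x / 3) ^ k) (x ^ 2 / 2 * (1 - x / 3)⁻¹) :=
    (hasSum_geometric_of_lt_one (by positivity) (by linarith)).mul_left _
  refine hasSum_le (fun k => ?_) (Real.hasSum_exp_sub_one_sub x) hg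
  have hfac : 2 * 3 ^ k ≤ (k + 2).factorial := by
    induction k with
    | zero => simp
    | succ k ih =>
      rw [show k + 1 + 2 = (k + 2) + 1 by ring, Nat.factorial_succ, pow_succ]
      nlinarith
  have hfac' : (2 : ℝ) * 3 ^ k ≤ ((k + 2).factorial : ℝ) := by exact_mod_cast hfac
  calc x ^ (k + 2) / ((k + 2).factorial : ℝ) ≤ x ^ (k + 2) / (2 * 3 ^ k) := by gcongr
    _ = _ := by rw [div_pow]; field_simp; ring

/-- The second-order remainder of the exponential is subquadratic under contractions. -/
theorem Real.exp_le_one_add_add_sq_mul {x y r : ℝ} (hx : 0 ≤ x) (hr : 0 ≤ r) (hr1 : r ≤ 1)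
    (hy : |y| ≤ r * x) : Real.exp y ≤ 1 + y + r ^ 2 * (Real.exp x - 1 - x) := by
  -- Termwise, `r ^ (k + 2) ≤ r ^ 2`. Keeping the factor `r ^ 2` matters: with `r = ‖c i‖` its mean
  -- is the variance of the coefficient.
  have h := hasSum_le (fun k => ?_) (Real.hasSum_exp_sub_one_sub y)
    ((Real.hasSum_exp_sub_one_sub x).mul_left (r ^ 2))
  · linarith
  · rw [← mul_div_assoc]
    gcongr
    calc y ^ (k + 2) ≤ |y| ^ (k + 2) := by rw [← abs_pow]; exact le_abs_self _
      _ ≤ (r * x) ^ (k + 2) := by gcongr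
      _ = r ^ 2 * x ^ (k + 2) * r ^ k := by ring
      _ ≤ r ^ 2 * x ^ (k + 2) * 1 := by
          gcongr
          exact pow_le_one₀ hr hr1
      _ = _ := mul_one _

namespace Matrix

variable {m n : Type*}

/-- The Hermitian dilation of a rectangular matrix. -/
def hermitianDilation (X : Matrix m n ℂ) : Matrix (m ⊕ n) (m ⊕ n) ℂ :=
  fromBlocks 0 X Xᴴ 0

theorem isHermitian_hermitianDilation (X : Matrix m n ℂ) : (hermitianDilation X).IsHermitian := by
  simp [IsHermitian, hermitianDilation, fromBlocks_conjTranspose]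

theorem hermitianDilation_add (X Y : Matrix m n ℂ) :
    hermitianDilation (X + Y) = hermitianDilation X + hermitianDilation Y := by
  simp [hermitianDilation, fromBlocks_add]

/-- The dilation is only real-linear. Separating `c` from `star c` lets each part be averaged by
independence. -/
theorem hermitianDilation_smul (c : ℂ) (X : Matrix m n ℂ) :
    hermitianDilation (c • X)
      = c • fromBlocks 0 X 0 0 + star c • fromBlocks 0 0 Xᴴ 0 := by
  simp [hermitianDilation, fromBlocks_add, fromBlocks_smul]

theorem continuous_hermitianDilation :
    Continuous (hermitianDilation : Matrix m n ℂ → Matrix (m ⊕ n) (m ⊕ n) ℂ) :=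
  continuous_const.matrix_fromBlocks continuous_id (continuous_id.matrix_conjTranspose)
    continuous_const

variable [Fintype m] [Fintype n] [DecidableEq n]

theorem norm_toEuclideanLin_le (X : Matrix m n ℂ) (x : EuclideanSpace ℂ n) :
    ‖(toEuclideanLin X) x‖ ≤ ‖X‖ * ‖x‖ :=
  l2_opNorm_mulVec X x

variable [DecidableEq m]

theorem norm_sq_toEuclideanLin_hermitianDilation (X : Matrix m n ℂ)
    (x : EuclideanSpace ℂ (m ⊕ n)) :
    ‖(toEuclideanLin (hermitianDilation X)) x‖ ^ 2
      = ‖(toEuclideanLin X) (WithLp.toLp 2 fun j => x (Sum.inr j))‖ ^ 2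
        + ‖(toEuclideanLin Xᴴ) (WithLp.toLp 2 fun i => x (Sum.inl i))‖ ^ 2 := by
  simp [EuclideanSpace.norm_sq_eq, Fintype.sum_sum_type, hermitianDilation, toLpLin_apply,
    mulVec, dotProduct]

/-- The dilation sends `(u, v)` to `(X v, Xᴴ u)`, and both blocks have norm `‖X‖`; vectors `(0, x)`
give the reverse bound. -/
theorem norm_hermitianDilation (X : Matrix m n ℂ) : ‖hermitianDilation X‖ = ‖X‖ := by
  refine le_antisymm ?_ ?_
  · refine ContinuousLinearMap.opNorm_le_bound _ (norm_nonneg _) fun x => ?_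
    refine le_of_sq_le_sq ?_ (by positivity)
    refine (norm_sq_toEuclideanLin_hermitianDilation X x).trans_le ?_
    have h1 := norm_toEuclideanLin_le X (WithLp.toLp 2 fun j => x (Sum.inr j))
    have h2 := norm_toEuclideanLin_le Xᴴ (WithLp.toLp 2 fun i => x (Sum.inl i))
    rw [l2_opNorm_conjTranspose] at h2
    have h3 : ‖x‖ ^ 2 = ‖(WithLp.toLp 2 fun j => x (Sum.inr j) : EuclideanSpace ℂ n)‖ ^ 2
        + ‖(WithLp.toLp 2 fun i => x (Sum.inl i) : EuclideanSpace ℂ m)‖ ^ 2 := by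
      simp [EuclideanSpace.norm_sq_eq, Fintype.sum_sum_type, add_comm]
    rw [mul_pow, h3, mul_add, ← mul_pow, ← mul_pow]
    gcongr
  · refine ContinuousLinearMap.opNorm_le_bound _ (norm_nonneg _) fun x => ?_
    have h1 := norm_toEuclideanLin_le (hermitianDilation X)
      (WithLp.toLp 2 (Sum.elim (0 : m → ℂ) x))
    have h2 := norm_sq_toEuclideanLin_hermitianDilation X
      (WithLp.toLp 2 (Sum.elim (0 : m → ℂ) x))
    have h3 : ‖(WithLp.toLp 2 (Sum.elim (0 : m → ℂ) x) : EuclideanSpace ℂ (m ⊕ n))‖ = ‖x‖ := by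
      simp [EuclideanSpace.norm_eq, Fintype.sum_sum_type]
    rw [h3] at h1
    refine le_trans (le_of_sq_le_sq ?_ (norm_nonneg _)) h1
    rw [h2]
    exact le_add_of_nonneg_right (sq_nonneg _)

/-- By spectral mapping `exp x` is one of the eigenvalues of `exp A`, which are nonnegative and sum
to the trace. -/
theorem IsHermitian.exp_le_trace_exp {A : Matrix n n ℂ} (hA : A.IsHermitian) {x : ℝ}
    (hx : x ∈ spectrum ℝ A) : Real.exp x ≤ (NormedSpace.exp A).trace.re := by
  have h1 : Real.exp x ∈ spectrum ℝ (NormedSpace.exp A) := by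
    rw [← CFC.real_exp_eq_normedSpace_exp hA.isSelfAdjoint,
      cfc_map_spectrum Real.exp A hA.isSelfAdjoint]
    exact ⟨x, hx, rfl⟩
  have hP := hA.posSemidef_exp
  rw [hP.1.spectrum_real_eq_range_eigenvalues] at h1
  obtain ⟨i, hi⟩ := h1
  rw [hP.1.trace_eq_sum_eigenvalues, ← hi]
  rw [Complex.re_sum]
  exact single_le_sum (f := fun j => ((hP.1.eigenvalues j : ℂ)).re)
    (fun j _ => hP.eigenvalues_nonneg j) (mem_univ i)

/-- Conjugation by `diag(1, -1)` reverses the sign of the dilation. Hence it does not matter which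
of `±‖X‖` is found in the spectrum. -/
theorem trace_exp_neg_hermitianDilation (X : Matrix m n ℂ) :
    (NormedSpace.exp (-hermitianDilation X)).trace
      = (NormedSpace.exp (hermitianDilation X)).trace := by
  set U : Matrix (m ⊕ n) (m ⊕ n) ℂ := fromBlocks 1 0 0 (-1) with hU
  have hUU : U * U = 1 := by simp [hU, fromBlocks_multiply, fromBlocks_one]
  have hinv : U⁻¹ = U := inv_eq_left_inv hUU
  have hunit : IsUnit U := .of_mul_eq_one _ hUU
  have hconj : -hermitianDilation X = U * hermitianDilation X * U⁻¹ := by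
    rw [hinv]
    simp [hU, hermitianDilation, fromBlocks_multiply, fromBlocks_neg]
  rw [hconj, exp_conj _ _ hunit, trace_mul_comm, ← mul_assoc, hinv, hUU, one_mul]

/-- The trace of the exponential of the Hermitian dilation controls the operator norm. -/
theorem exp_norm_le_trace_exp_hermitianDilation [Nonempty n] (X : Matrix m n ℂ) :
    Real.exp ‖X‖ ≤ (NormedSpace.exp (hermitianDilation X)).trace.re := by
  have hH := isHermitian_hermitianDilation X
  rcases CStarAlgebra.norm_or_neg_norm_mem_spectrum hH.isSelfAdjoint with h | h
  · rw [norm_hermitianDilation] at h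
    exact hH.exp_le_trace_exp h
  · rw [norm_hermitianDilation] at h
    rw [← trace_exp_neg_hermitianDilation]
    refine hH.neg.exp_le_trace_exp ?_
    rw [← spectrum.neg_eq]
    simpa using h

/-- An operator version of `Real.exp_le_one_add_add_sq_mul`. -/
theorem IsHermitian.exp_le_one_add_add_sq_mul {A : Matrix n n ℂ} (hA : A.IsHermitian) {x r : ℝ}
    (hx : 0 ≤ x) (hr : 0 ≤ r) (hr1 : r ≤ 1) (hAn : ‖A‖ ≤ r * x) :
    (((1 + r ^ 2 * (Real.exp x - 1 - x) : ℝ) : ℂ) • 1 + A - NormedSpace.exp A).PosSemidef := by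
  rcases isEmpty_or_nonempty n with hn | hn
  · rw [Subsingleton.elim (_ + A - _) 0]
    exact .zero
  have hs : IsSelfAdjoint A := hA.isSelfAdjoint
  have h := cfc_mono (a := A) (f := Real.exp)
    (g := fun y => (1 + r ^ 2 * (Real.exp x - 1 - x)) + y) (fun y hy => ?_)
    (Real.continuous_exp.continuousOn) (by fun_prop)
  · rw [cfc_const_add _ _ _ , cfc_id' ℝ A, CFC.real_exp_eq_normedSpace_exp hs, le_iff] at h
    convert! h using 3
    rw [Algebra.algebraMap_eq_smul_one, Complex.coe_smul]
  · have := Real.exp_le_one_add_add_sq_mul (y := y) hx hr hr1 ?_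
    · linarith
    · have := spectrum.norm_le_norm_of_mem hy
      exact this.trans hAn

/-- Golden–Thompson, then the operator bound on `exp` of the dilation, paired with the positive
semidefinite `exp A`. The last term is the one that averages to zero. -/
theorem trace_exp_add_hermitianDilation_le {A : Matrix (m ⊕ n) (m ⊕ n) ℂ} (hA : A.IsHermitian)
    (X : Matrix m n ℂ) {x r : ℝ} (hx : 0 ≤ x) (hr : 0 ≤ r) (hr1 : r ≤ 1) (hX : ‖X‖ ≤ r * x) :
    (NormedSpace.exp (A + hermitianDilation X)).trace.re
      ≤ (1 + r ^ 2 * (Real.exp x - 1 - x)) * (NormedSpace.exp A).trace.re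
        + (NormedSpace.exp A * hermitianDilation X).trace.re := by
  have hD := isHermitian_hermitianDilation X
  refine (hA.trace_exp_add_le hD).trans ?_
  have h := hA.posSemidef_exp.trace_mul_nonneg
    (hD.exp_le_one_add_add_sq_mul hx hr hr1 ((norm_hermitianDilation X).trans_le hX))
  have h2 := (Complex.le_def.mp h).1
  rw [mul_sub, mul_add, trace_sub, trace_add, mul_smul_comm, mul_one, trace_smul, smul_eq_mul,
    Complex.sub_re, Complex.add_re, Complex.re_ofReal_mul, Complex.zero_re] at h2
  linarith

end Matrix

end Dilation

/-! ### Matrix Bernstein inequality for series with random scalar coefficients. -/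

section MatrixBernstein

open Matrix Finset

variable {Ω : Type*} [MeasurableSpace Ω] {P : Measure Ω}
  {ι : Type*} [Fintype ι] {c : ι → Ω → ℂ}

/-- The coefficients almost surely lie in a compact polydisc, on which a continuous function is
bounded. -/
theorem integrable_comp_of_ae_norm_le_one [IsProbabilityMeasure P] {E : Type*} [NormedAddCommGroup E]
    (hc : ∀ i, Measurable (c i)) (hb : ∀ i, ∀ᵐ ω ∂P, ‖c i ω‖ ≤ 1) {g : (ι → ℂ) → E}
    (hg : Continuous g) : Integrable (fun ω => g fun i => c i ω) P := by
  obtain ⟨C, hC⟩ := (isCompact_closedBall (0 : ι → ℂ) 1).exists_bound_of_continuousOn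
    hg.continuousOn
  refine Integrable.of_bound (hg.comp_aestronglyMeasurable
    (measurable_pi_lambda _ hc).aestronglyMeasurable) C ?_
  filter_upwards [ae_all_iff.mpr hb] with ω hω
  refine hC _ ?_
  rw [mem_closedBall_zero_iff, pi_norm_le_iff_of_nonneg zero_le_one]
  exact hω

namespace Matrix

variable {m n : Type*}

theorem indepFun_comp_sum_smul (hc : ∀ i, Measurable (c i)) (hind : iIndepFun c P)
    (B : ι → Matrix m n ℂ) {s : Finset ι} {a : ι} (ha : a ∉ s) {E : Type*} [TopologicalSpace E]
    [MeasurableSpace E] [BorelSpace E] {Φ : Matrix m n ℂ → E} (hΦ : Continuous Φ) :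
    IndepFun (fun ω => Φ (∑ i ∈ s, c i ω • B i)) (c a) P := by
  have h := hind.indepFun_finset s {a} (by simpa using ha) hc
  have hψ : Measurable fun z : s → ℂ => Φ (∑ i : s, z i • B i) := by
    refine (hΦ.comp ?_).measurable
    fun_prop
  have h2 := h.comp hψ (measurable_pi_apply (⟨a, mem_singleton_self a⟩ : ({a} : Finset ι)))
  convert! h2 using 1
  funext ω
  exact congrArg Φ (sum_coe_sort s fun i => c i ω • B i).symm

variable [Fintype m] [Fintype n] [DecidableEq m] [DecidableEq n]

theorem continuous_exp_hermitianDilation :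
    Continuous fun X : Matrix m n ℂ => NormedSpace.exp (hermitianDilation X) :=
  letI : NormedAlgebra ℚ (Matrix (m ⊕ n) (m ⊕ n) ℂ) := NormedAlgebra.restrictScalars ℚ ℂ _
  NormedSpace.exp_continuous.comp continuous_hermitianDilation

variable [IsProbabilityMeasure P]

/-- The trace moment generating function of a random matrix series with independent, centred and
bounded coefficients. -/
theorem integral_trace_exp_hermitianDilation_sum_le (hc : ∀ i, Measurable (c i))
    (hind : iIndepFun c P) (hb : ∀ i, ∀ᵐ ω ∂P, ‖c i ω‖ ≤ 1) (h0 : ∀ i, ∫ ω, c i ω ∂P = 0) {q : ℝ}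
    (hq : ∀ i, ∫ ω, ‖c i ω‖ ^ 2 ∂P ≤ q) (B : ι → Matrix m n ℂ) {x : ℝ} (hx : 0 ≤ x)
    (hB : ∀ i, ‖B i‖ ≤ x) (s : Finset ι) :
    ∫ ω, (NormedSpace.exp (hermitianDilation (∑ i ∈ s, c i ω • B i))).trace.re ∂P
      ≤ (Fintype.card m + Fintype.card n) * (1 + q * (Real.exp x - 1 - x)) ^ #s := by
  classical
  have hk : 0 ≤ Real.exp x - 1 - x := by linarith [Real.add_one_le_exp x]
  induction s using Finset.induction_on with
  | empty => simp [hermitianDilation, Fintype.card_sum]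
  | insert a s ha ih =>
    set T : Finset ι → Ω → ℝ := fun s ω =>
      (NormedSpace.exp (hermitianDilation (∑ i ∈ s, c i ω • B i))).trace.re with hT
    set W : Matrix (m ⊕ n) (m ⊕ n) ℂ → Ω → ℂ := fun C ω =>
      (NormedSpace.exp (hermitianDilation (∑ i ∈ s, c i ω • B i)) * C).trace with hW
    have hcT : ∀ s : Finset ι, Continuous fun z : ι → ℂ =>
        (NormedSpace.exp (hermitianDilation (∑ i ∈ s, z i • B i))).trace.re := fun s =>
      Complex.continuous_re.comp ((continuous_exp_hermitianDilation.comp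
        (by fun_prop)).matrix_trace)
    have hcW : ∀ C, Continuous fun z : ι → ℂ =>
        (NormedSpace.exp (hermitianDilation (∑ i ∈ s, z i • B i)) * C).trace := fun C =>
      ((continuous_exp_hermitianDilation.comp (by fun_prop)).mul continuous_const).matrix_trace
    have hsq : ∫ ω, ‖c a ω‖ ^ 2 * T s ω ∂P = (∫ ω, ‖c a ω‖ ^ 2 ∂P) * ∫ ω, T s ω ∂P := by
      have h := indepFun_comp_sum_smul hc hind B ha
        (Complex.continuous_re.comp (continuous_exp_hermitianDilation.matrix_trace))
      exact (h.symm.comp (φ := fun z : ℂ => ‖z‖ ^ 2) (by fun_prop)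
        measurable_id).integral_fun_mul_eq_mul_integral
        ((hc a).norm.pow_const 2).aestronglyMeasurable
        (integrable_comp_of_ae_norm_le_one hc hb (hcT s)).aestronglyMeasurable
    have hlin : ∀ C, ∫ ω, c a ω * W C ω ∂P = 0 := by
      intro C
      have h := indepFun_comp_sum_smul hc hind B ha
        ((continuous_exp_hermitianDilation.mul (continuous_const (y := C))).matrix_trace)
      refine (h.symm.integral_fun_mul_eq_mul_integral (hc a).aestronglyMeasurable
        (integrable_comp_of_ae_norm_le_one hc hb (hcW C)).aestronglyMeasurable).trans ?_
      rw [h0, zero_mul]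
    have hlin' : ∀ C, ∫ ω, star (c a ω) * W C ω ∂P = 0 := by
      intro C
      have h := indepFun_comp_sum_smul hc hind B ha
        ((continuous_exp_hermitianDilation.mul (continuous_const (y := C))).matrix_trace)
      refine ((h.symm.comp (φ := fun z : ℂ => star z) (by fun_prop)
        measurable_id).integral_fun_mul_eq_mul_integral
        (by fun_prop)
        (integrable_comp_of_ae_norm_le_one hc hb (hcW C)).aestronglyMeasurable).trans ?_
      have : ∫ ω, star (c a ω) ∂P = 0 := by
        simpa [h0] using integral_conj (μ := P) (f := c a)
      simp only [Function.comp_def, this, zero_mul]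
    set C₁ : Matrix (m ⊕ n) (m ⊕ n) ℂ := fromBlocks 0 (B a) 0 0 with hC₁
    set C₂ : Matrix (m ⊕ n) (m ⊕ n) ℂ := fromBlocks 0 0 (B a)ᴴ 0 with hC₂
    -- The one-summand bound with `r = ‖c a ω‖`. The last term is linear in `c a` and its conjugate,
    -- so it has mean zero by `hlin` and `hlin'`.
    have hpt : ∀ᵐ ω ∂P, T (insert a s) ω ≤ T s ω + (Real.exp x - 1 - x) * (‖c a ω‖ ^ 2 * T s ω)
        + (c a ω * W C₁ ω + star (c a ω) * W C₂ ω).re := by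
      filter_upwards [hb a] with ω hω
      have h := trace_exp_add_hermitianDilation_le
        (isHermitian_hermitianDilation (∑ i ∈ s, c i ω • B i)) (c a ω • B a) hx (norm_nonneg _) hω
        ((norm_smul_le _ _).trans (mul_le_mul_of_nonneg_left (hB a) (norm_nonneg _)))
      rw [← hermitianDilation_add, hermitianDilation_smul, mul_add, mul_smul_comm, mul_smul_comm,
        trace_add, trace_smul, trace_smul, add_comm (∑ i ∈ s, c i ω • B i),
        ← sum_insert ha (f := fun i => c i ω • B i)] at h
      refine h.trans_eq ?_
      simp only [hT, hW, smul_eq_mul]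
      ring
    have hi1 : Integrable (T s) P := integrable_comp_of_ae_norm_le_one hc hb (hcT s)
    have hi2 : Integrable (fun ω => ‖c a ω‖ ^ 2 * T s ω) P :=
      integrable_comp_of_ae_norm_le_one hc hb
        (g := fun z => ‖z a‖ ^ 2 * (NormedSpace.exp (hermitianDilation
          (∑ i ∈ s, z i • B i))).trace.re) (by have := hcT s; fun_prop)
    have hi3 : Integrable (fun ω => c a ω * W C₁ ω) P :=
      integrable_comp_of_ae_norm_le_one hc hb
        (g := fun z => z a * (NormedSpace.exp (hermitianDilation
          (∑ i ∈ s, z i • B i)) * C₁).trace) (by have := hcW C₁; fun_prop)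
    have hi4 : Integrable (fun ω => star (c a ω) * W C₂ ω) P :=
      integrable_comp_of_ae_norm_le_one hc hb
        (g := fun z => star (z a) * (NormedSpace.exp (hermitianDilation
          (∑ i ∈ s, z i • B i)) * C₂).trace) (by have := hcW C₂; fun_prop)
    have hi5 : Integrable (fun ω => (c a ω * W C₁ ω + star (c a ω) * W C₂ ω).re) P :=
      (hi3.add hi4).re
    have hre : ∫ ω, (c a ω * W C₁ ω + star (c a ω) * W C₂ ω).re ∂P = 0 := by
      have h := integral_re (𝕜 := ℂ) (hi3.add hi4)
      simp only [RCLike.re_to_complex, Pi.add_apply] at h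
      rw [h, integral_add hi3 hi4, hlin, hlin']
      simp
    have hT0 : 0 ≤ ∫ ω, T s ω ∂P := integral_nonneg fun ω =>
      (isHermitian_hermitianDilation _).posSemidef_exp.trace_re_nonneg
    have hq0 : 0 ≤ q := (integral_nonneg fun ω => sq_nonneg _).trans (hq a)
    calc ∫ ω, T (insert a s) ω ∂P
        ≤ ∫ ω, (T s ω + (Real.exp x - 1 - x) * (‖c a ω‖ ^ 2 * T s ω)
          + (c a ω * W C₁ ω + star (c a ω) * W C₂ ω).re) ∂P :=
          integral_mono_ae (integrable_comp_of_ae_norm_le_one hc hb (hcT _))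
            ((hi1.add (hi2.const_mul _)).add hi5) hpt
      _ = (1 + (∫ ω, ‖c a ω‖ ^ 2 ∂P) * (Real.exp x - 1 - x)) * ∫ ω, T s ω ∂P := by
          have hi6 : Integrable (fun ω => T s ω + (Real.exp x - 1 - x) * (‖c a ω‖ ^ 2 * T s ω)) P :=
            hi1.add (hi2.const_mul _)
          rw [integral_add hi6 hi5, hre, integral_add hi1 (hi2.const_mul _), integral_const_mul, hsq]
          ring
      _ ≤ (1 + q * (Real.exp x - 1 - x)) * ((Fintype.card m + Fintype.card n)
            * (1 + q * (Real.exp x - 1 - x)) ^ #s) := by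
          gcongr
          exact hq a
      _ = _ := by rw [card_insert_of_notMem ha, pow_succ]; ring

/-- **Matrix Bernstein inequality** for a random matrix series with independent, centred and
bounded coefficients. -/
theorem measureReal_le_norm_sum_smul_le [Nonempty n] (hc : ∀ i, Measurable (c i))
    (hind : iIndepFun c P) (hb : ∀ i, ∀ᵐ ω ∂P, ‖c i ω‖ ≤ 1) (h0 : ∀ i, ∫ ω, c i ω ∂P = 0) {q : ℝ}
    (hq0 : 0 < q) (hq : ∀ i, ∫ ω, ‖c i ω‖ ^ 2 ∂P ≤ q) (B : ι → Matrix m n ℂ) {L : ℝ} (hL : 0 < L)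
    (hB : ∀ i, ‖B i‖ ≤ L) {v : ℝ} (hv0 : 0 < v) (hv : Fintype.card ι * (q * L ^ 2) ≤ v) {t : ℝ}
    (ht : 0 ≤ t) :
    P.real {ω | t ≤ ‖∑ i, c i ω • B i‖}
      ≤ (Fintype.card m + Fintype.card n) * Real.exp (-(t ^ 2 / 2) / (v + L * t / 3)) := by
  -- The usual Bernstein parameter: it keeps `θ L < 3`, makes `1 - θ L / 3 = v / (v + L t / 3)`, and
  -- so gives the stated exponent after Markov's inequality.
  set θ : ℝ := t / (v + L * t / 3) with hθ
  have hden : 0 < v + L * t / 3 := by positivity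
  have hθ0 : 0 ≤ θ := by positivity
  have hθL : θ * L < 3 := by
    rw [hθ, div_mul_eq_mul_div, div_lt_iff₀ hden]
    linarith
  have hmgf := integral_trace_exp_hermitianDilation_sum_le hc hind hb h0 hq
    (fun i => (θ : ℂ) • B i) (mul_nonneg hθ0 hL.le) (fun i => by
      rw [norm_smul, Complex.norm_real, Real.norm_of_nonneg hθ0]
      exact mul_le_mul_of_nonneg_left (hB i) hθ0) univ
  have hsum : ∀ ω, ∑ i, c i ω • (θ : ℂ) • B i = (θ : ℂ) • ∑ i, c i ω • B i := fun ω => by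
    rw [smul_sum]
    exact sum_congr rfl fun i _ => smul_comm _ _ _
  simp only [hsum] at hmgf
  set Z : Ω → ℝ := fun ω =>
    (NormedSpace.exp (hermitianDilation ((θ : ℂ) • ∑ i, c i ω • B i))).trace.re with hZ
  have hZint : Integrable Z P :=
    integrable_comp_of_ae_norm_le_one hc hb (g := fun z => (NormedSpace.exp
      (hermitianDilation ((θ : ℂ) • ∑ i, z i • B i))).trace.re)
      (Complex.continuous_re.comp ((continuous_exp_hermitianDilation.comp
        (by fun_prop)).matrix_trace))
  have hexp : ∀ ω, Real.exp (θ * ‖∑ i, c i ω • B i‖) ≤ Z ω := fun ω => by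
    have h := exp_norm_le_trace_exp_hermitianDilation ((θ : ℂ) • ∑ i, c i ω • B i)
    rwa [norm_smul, Complex.norm_real, Real.norm_of_nonneg hθ0] at h
  have hsub : {ω | t ≤ ‖∑ i, c i ω • B i‖} ⊆ {ω | Real.exp (θ * t) ≤ Z ω} := fun ω hω => by
    refine le_trans (Real.exp_le_exp.mpr ?_) (hexp ω)
    exact mul_le_mul_of_nonneg_left hω hθ0
  have hmarkov := mul_meas_ge_le_integral_of_nonneg (μ := P) (f := Z)
    (.of_forall fun ω => (Real.exp_pos _).le.trans (hexp ω)) hZint (Real.exp (θ * t))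
  -- Uses `1 + u ≤ exp u`, the remainder bound at `θ L`, and the hypothesis on `v`.
  have hpow : (1 + q * (Real.exp (θ * L) - 1 - θ * L)) ^ Fintype.card ι
      ≤ Real.exp (θ ^ 2 * v / 2 / (1 - θ * L / 3)) := by
    have hk : 0 ≤ Real.exp (θ * L) - 1 - θ * L := by linarith [Real.add_one_le_exp (θ * L)]
    have h13 : 0 < 1 - θ * L / 3 := by linarith
    calc _ ≤ Real.exp (q * (Real.exp (θ * L) - 1 - θ * L)) ^ Fintype.card ι := by
          gcongr
          linarith [Real.add_one_le_exp (q * (Real.exp (θ * L) - 1 - θ * L))]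
      _ ≤ Real.exp (q * ((θ * L) ^ 2 / 2 / (1 - θ * L / 3))) ^ Fintype.card ι := by
          gcongr
          exact Real.exp_sub_one_sub_le (by positivity) hθL
      _ = Real.exp (θ ^ 2 * (Fintype.card ι * (q * L ^ 2)) / 2 / (1 - θ * L / 3)) := by
          rw [← Real.exp_nat_mul]
          congr 1
          ring
      _ ≤ _ := by gcongr
  have hexpo : θ ^ 2 * v / 2 / (1 - θ * L / 3) - θ * t = -(t ^ 2 / 2) / (v + L * t / 3) := by
    have h13 : 1 - θ * L / 3 = v / (v + L * t / 3) := by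
      rw [hθ]
      field_simp
      ring
    rw [h13, hθ]
    field_simp
    ring
  calc P.real {ω | t ≤ ‖∑ i, c i ω • B i‖} ≤ P.real {ω | Real.exp (θ * t) ≤ Z ω} :=
        measureReal_mono hsub
    _ ≤ (∫ ω, Z ω ∂P) / Real.exp (θ * t) := by
        rw [le_div_iff₀ (Real.exp_pos _), mul_comm]
        exact hmarkov
    _ ≤ (Fintype.card m + Fintype.card n)
          * Real.exp (θ ^ 2 * v / 2 / (1 - θ * L / 3)) / Real.exp (θ * t) := by
        gcongr
        exact hmgf.trans (mul_le_mul_of_nonneg_left hpow (by positivity))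
    _ = _ := by rw [mul_div_assoc, ← Real.exp_sub, hexpo]

end Matrix

end MatrixBernstein

/-! ### Orthogonality of characters and the norm of each tone matrix. -/

section RadarNorm

open Matrix Finset

theorem sum_exp_two_pi_mul_I_mul_div_eq_zero {K : ℕ} (hK : K ≠ 0) {l : ℤ} (hl : ¬ (K : ℤ) ∣ l) :
    ∑ s : Fin K, Complex.exp (2 * Real.pi * Complex.I * (l / K)) ^ (s : ℕ) = 0 := by
  have hK' : (K : ℂ) ≠ 0 := by exact_mod_cast hK
  set z := Complex.exp (2 * Real.pi * Complex.I * (l / K)) with hz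
  have hz1 : z ≠ 1 := by
    rw [hz, Ne, Complex.exp_eq_one_iff]
    rintro ⟨k, hk⟩
    refine hl ⟨k, ?_⟩
    rw [mul_comm (k : ℂ)] at hk
    have h := mul_left_cancel₀ Complex.two_pi_I_ne_zero hk
    rw [div_eq_iff hK'] at h
    rw [mul_comm]
    exact_mod_cast h
  have hzK : z ^ K = 1 := by
    rw [hz, ← Complex.exp_nat_mul, Complex.exp_eq_one_iff]
    exact ⟨l, by field_simp⟩
  rw [Fin.sum_univ_eq_sum_range (fun s => z ^ s) K]
  refine eq_zero_of_ne_zero_of_mul_left_eq_zero (sub_ne_zero_of_ne hz1.symm) ?_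
  rw [mul_neg_geom_sum, hzK, sub_self]

theorem Complex.exp_I_mul_ofReal_mul_star (x y : ℝ) :
    Complex.exp (Complex.I * x) * star (Complex.exp (Complex.I * y))
      = Complex.exp (Complex.I * ((x - y : ℝ) : ℂ)) := by
  rw [Complex.star_def, ← Complex.exp_conj, ← Complex.exp_add]
  congr 1
  simp
  ring

namespace Matrix

/-- Rows of characters with distinct frequencies modulo `K` are orthogonal. -/
theorem mul_conjTranspose_of_phases {R K : ℕ} (hK : K ≠ 0) (a : ℝ) (φ : Fin R → Fin K → ℝ)
    (h : ∀ k k', k ≠ k' → ∃ (b : ℝ) (l : ℤ), ¬ (K : ℤ) ∣ l ∧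
      ∀ s, φ k s - φ k' s = b + 2 * Real.pi * (l / K) * (s : ℕ)) :
    (of fun k s => (a : ℂ) * Complex.exp (Complex.I * (φ k s : ℂ)))
      * (of fun k s => (a : ℂ) * Complex.exp (Complex.I * (φ k s : ℂ)))ᴴ
      = ((K * a ^ 2 : ℝ) : ℂ) • 1 := by
  ext k k'
  have hterm : ∀ s, (a : ℂ) * Complex.exp (Complex.I * (φ k s : ℂ))
      * star ((a : ℂ) * Complex.exp (Complex.I * (φ k' s : ℂ)))
      = (a : ℂ) ^ 2 * Complex.exp (Complex.I * ((φ k s - φ k' s : ℝ) : ℂ)) := by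
    intro s
    rw [← Complex.exp_I_mul_ofReal_mul_star, star_mul', Complex.star_def, Complex.conj_ofReal]
    ring
  simp only [mul_apply, conjTranspose_apply, of_apply, hterm, smul_apply, one_apply]
  by_cases hkk : k = k'
  · subst hkk
    simp
  · obtain ⟨b, l, hl, hφ⟩ := h k k' hkk
    have hs : ∀ s : Fin K, (a : ℂ) ^ 2 * Complex.exp (Complex.I * ((φ k s - φ k' s : ℝ) : ℂ))
        = (a : ℂ) ^ 2 * Complex.exp (Complex.I * b)
          * Complex.exp (2 * Real.pi * Complex.I * (l / K)) ^ (s : ℕ) := by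
      intro s
      rw [hφ, ← Complex.exp_nat_mul, mul_assoc ((a : ℂ) ^ 2), ← Complex.exp_add]
      congr 2
      push_cast
      ring
    simp only [hs, ← mul_sum, sum_exp_two_pi_mul_I_mul_div_eq_zero hK hl, mul_zero, if_neg hkk,
      smul_zero]

theorem diagonal_exp_mul_conjTranspose {n : Type*} [Fintype n] [DecidableEq n] (φ : n → ℝ) :
    diagonal (fun s => Complex.exp (Complex.I * (φ s : ℂ)))
      * (diagonal fun s => Complex.exp (Complex.I * (φ s : ℂ)))ᴴ = 1 := by
  rw [diagonal_conjTranspose, diagonal_mul_diagonal, ← diagonal_one]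
  congr 1
  funext s
  rw [Pi.star_apply, Complex.exp_I_mul_ofReal_mul_star]
  simp

/-- The C*-identity for `Bᴴ`. -/
theorem norm_le_of_mul_conjTranspose_eq_smul_one {m n : Type*} [Fintype m] [Fintype n]
    [DecidableEq m] [DecidableEq n] {B : Matrix m n ℂ} {L : ℝ} (hL : 0 ≤ L)
    (hB : B * Bᴴ = ((L ^ 2 : ℝ) : ℂ) • 1) : ‖B‖ ≤ L := by
  have h := l2_opNorm_conjTranspose_mul_self Bᴴ
  rw [conjTranspose_conjTranspose, hB, l2_opNorm_conjTranspose, norm_smul, Complex.norm_real,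
    Real.norm_of_nonneg (by positivity), ← pow_two] at h
  have h1 : ‖(1 : Matrix m m ℂ)‖ ≤ 1 := by
    rw [← diagonal_one, l2_opNorm_diagonal, pi_norm_le_iff_of_nonneg zero_le_one]
    simp
  refine le_of_sq_le_sq ?_ hL
  rw [← h]
  exact mul_le_of_le_one_right (by positivity) h1

end Matrix

theorem not_dvd_sub_of_ne {K a b : ℕ} (ha : a < K) (hb : b < K) (hab : a ≠ b) :
    ¬ (K : ℤ) ∣ (a : ℤ) - b := by
  intro h
  have h0 := Int.eq_zero_of_abs_lt_dvd h (by rw [abs_lt]; constructor <;> omega)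
  omega

namespace MIMORadar

variable (S : MIMORadar)

/-- With spacing `NT / 2`, the phase difference of receivers `k`, `k'` advances by `2π (k - k') NT /
(NR NT)` per angle bin, and `|k - k'| < NR` keeps the frequency nonzero modulo `NR NT`. -/
theorem alphaR_mul_conjTranspose : S.alphaR * S.alphaRᴴ = 1 := by
  have hR : (0 : ℝ) < S.NR := by exact_mod_cast S.NR_pos
  have hT : (0 : ℝ) < S.NT := by exact_mod_cast S.NT_pos
  have hK : S.Ntheta ≠ 0 := (Nat.mul_pos S.NR_pos S.NT_pos).ne'
  refine (mul_conjTranspose_of_phases hK _ _ fun k k' hkk => ?_).trans ?_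
  · refine ⟨-Real.pi * S.NT * ((k : ℕ) - (k' : ℕ)), ((k : ℕ) - (k' : ℕ) : ℤ) * S.NT, ?_, ?_⟩
    · rw [show ((S.Ntheta : ℕ) : ℤ) = (S.NR : ℤ) * S.NT by push_cast; rfl,
        Int.mul_dvd_mul_iff_right (by exact_mod_cast S.NT_pos.ne')]
      exact not_dvd_sub_of_ne k.2 k'.2 fun h => hkk (Fin.ext h)
    · intro s
      simp only [dR, theta]
      push_cast
      field_simp
  · rw [Real.sq_sqrt (by positivity)]
    push_cast
    rw [mul_one_div_cancel (by exact_mod_cast (mul_pos hR hT).ne'), one_smul]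

/-- Rows are characters modulo `N`; `M ≤ N` keeps their frequencies distinct. -/
theorem Abar_mul_conjTranspose :
    S.Abar * S.Abarᴴ = (((S.N : ℝ) / (S.M * S.Nc) : ℝ) : ℂ) • 1 := by
  have hN : (0 : ℝ) < S.N := by exact_mod_cast S.N_pos
  have hM : (0 : ℝ) < S.M := by exact_mod_cast S.M_pos
  have hc : (0 : ℝ) < S.Nc := by exact_mod_cast S.Nc_pos
  refine (mul_conjTranspose_of_phases S.N_pos.ne' _ _ fun n n' hnn => ?_).trans ?_
  · refine ⟨0, ((n' : ℕ) - (n : ℕ) : ℤ), ?_, ?_⟩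
    · exact not_dvd_sub_of_ne (n'.2.trans_le S.M_le_N) (n.2.trans_le S.M_le_N)
        fun h => hnn (Fin.ext h.symm)
    · intro r
      push_cast
      ring
  · rw [div_pow, Real.sq_sqrt (by positivity)]
    congr 2
    ring

/-- The contribution of one tone to the sensing matrix. -/
noncomputable def toneMatrix (i : Fin S.N) :
    Matrix (Fin S.NR × Fin S.M) (Fin S.Ntheta × Fin S.N) ℂ :=
  (S.alphaR * S.alphaT (S.xi i)) ⊗ₖ (S.H ((i : ℕ) + 1) * S.Abar * S.D ((i : ℕ) + 1))

theorem toneMatrix_mul_conjTranspose (i : Fin S.N) :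
    S.toneMatrix i * (S.toneMatrix i)ᴴ = (((S.N : ℝ) / (S.M * S.Nc) : ℝ) : ℂ) • 1 := by
  have hT : S.alphaT (S.xi i) * (S.alphaT (S.xi i))ᴴ = 1 := diagonal_exp_mul_conjTranspose _
  have hH : S.H ((i : ℕ) + 1) * (S.H ((i : ℕ) + 1))ᴴ = 1 := diagonal_exp_mul_conjTranspose _
  have hD : S.D ((i : ℕ) + 1) * (S.D ((i : ℕ) + 1))ᴴ = 1 := diagonal_exp_mul_conjTranspose _
  have h1 : S.alphaR * S.alphaT (S.xi i) * (S.alphaR * S.alphaT (S.xi i))ᴴ = 1 := by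
    rw [conjTranspose_mul, Matrix.mul_assoc, ← Matrix.mul_assoc (S.alphaT _), hT, Matrix.one_mul,
      alphaR_mul_conjTranspose]
  have h2 : S.H ((i : ℕ) + 1) * S.Abar * S.D ((i : ℕ) + 1)
      * (S.H ((i : ℕ) + 1) * S.Abar * S.D ((i : ℕ) + 1))ᴴ
      = (((S.N : ℝ) / (S.M * S.Nc) : ℝ) : ℂ) • 1 := by
    rw [conjTranspose_mul, Matrix.mul_assoc, ← Matrix.mul_assoc (S.D _), hD, Matrix.one_mul, conjTranspose_mul,
      Matrix.mul_assoc, ← Matrix.mul_assoc S.Abar, Abar_mul_conjTranspose, Matrix.smul_mul, Matrix.one_mul,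
      Matrix.mul_smul, hH]
  rw [toneMatrix, conjTranspose_kronecker, ← mul_kronecker_mul, h1, h2, kronecker_smul,
    one_kronecker_one]

theorem norm_toneMatrix_le (i : Fin S.N) :
    ‖S.toneMatrix i‖ ≤ Real.sqrt ((S.N : ℝ) / (S.M * S.Nc)) := by
  refine norm_le_of_mul_conjTranspose_eq_smul_one (Real.sqrt_nonneg _) ?_
  rw [Real.sq_sqrt (by positivity), toneMatrix_mul_conjTranspose]

end MIMORadar

end RadarNorm

/-! ### Independence and moments of the tone coefficients. -/

section RadarProbability

open Finset

variable {Ω : Type*} [MeasurableSpace Ω] {P : Measure Ω}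

/-- A finite family is independent if each member is independent of any family of other members. -/
theorem iIndepFun_of_indepFun_finset [IsProbabilityMeasure P] {ι E : Type*} [MeasurableSpace E]
    {c : ι → Ω → E}
    (h : ∀ (s : Finset ι) (a : ι), a ∉ s → IndepFun (fun ω (i : s) => c i ω) (c a) P) :
    iIndepFun c P := by
  classical
  rw [iIndepFun_iff_measure_inter_preimage_eq_mul]
  intro s A hA
  induction s using Finset.induction_on with
  | empty => simp
  | insert a s ha ih =>
    have hset : ⋂ i ∈ s, c i ⁻¹' A i
        = (fun ω (i : s) => c i ω) ⁻¹' Set.pi Set.univ fun i : s => A i := by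
      ext ω
      simp
    have hm : MeasurableSet (Set.pi Set.univ fun i : s => A i) :=
      MeasurableSet.univ_pi fun i => hA i (mem_insert_of_mem i.2)
    rw [prod_insert ha, ← ih fun i hi => hA i (mem_insert_of_mem hi), set_biInter_insert,
      Set.inter_comm, hset,
      (h s a ha).measure_inter_preimage_eq_mul _ _ hm (hA a (mem_insert_self a s)), mul_comm]

/-- Functions of the pairs formed from two jointly independent families are independent. -/
theorem iIndepFun_comp_pair [IsProbabilityMeasure P] {ι E F : Type*} [MeasurableSpace E]
    [MeasurableSpace F] {X Y : ι → Ω → E} (hX : ∀ i, Measurable (X i)) (hY : ∀ i, Measurable (Y i))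
    (h : iIndepFun (Sum.elim X Y) P) {g : E → E → F} (hg : Measurable fun p : E × E => g p.1 p.2) :
    iIndepFun (fun i ω => g (X i ω) (Y i ω)) P := by
  classical
  refine iIndepFun_of_indepFun_finset fun s a ha => ?_
  have hm : ∀ j, Measurable (Sum.elim X Y j) := by
    rintro (i | i)
    exacts [hX i, hY i]
  -- Take both copies of `s` against both copies of `a` in the joint family; these index sets are
  -- disjoint.
  have hi := h.indepFun_finset (s.disjSum s) (({a} : Finset ι).disjSum {a})
    (by
      rw [disjoint_left]
      rintro (i | i) h1 h2 <;> simp at h1 h2 <;> exact ha (h2 ▸ h1)) hm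
  have hφ : Measurable fun (z : s.disjSum s → E) (i : s) =>
      g (z ⟨Sum.inl i, inl_mem_disjSum.mpr i.2⟩) (z ⟨Sum.inr i, inr_mem_disjSum.mpr i.2⟩) :=
    measurable_pi_lambda _ fun i => hg.comp (f := fun z : s.disjSum s → E =>
      (z ⟨Sum.inl i, inl_mem_disjSum.mpr i.2⟩, z ⟨Sum.inr i, inr_mem_disjSum.mpr i.2⟩))
      ((measurable_pi_apply _).prodMk (measurable_pi_apply _))
  have hψ : Measurable fun (z : ({a} : Finset ι).disjSum {a} → E) =>
      g (z ⟨Sum.inl a, inl_mem_disjSum.mpr (mem_singleton_self a)⟩)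
        (z ⟨Sum.inr a, inr_mem_disjSum.mpr (mem_singleton_self a)⟩) :=
    hg.comp (f := fun z : ({a} : Finset ι).disjSum {a} → E =>
      (z ⟨Sum.inl a, inl_mem_disjSum.mpr (mem_singleton_self a)⟩,
        z ⟨Sum.inr a, inr_mem_disjSum.mpr (mem_singleton_self a)⟩))
      ((measurable_pi_apply _).prodMk (measurable_pi_apply _))
  exact hi.comp hφ hψ

theorem integral_exp_I_mul_eq_zero_of_isUniform {X : Ω → ℝ} (hX : Measurable X)
    (h : pdf.IsUniform X (Set.Icc 0 (2 * Real.pi)) P volume) :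
    ∫ ω, Complex.exp (Complex.I * (X ω : ℂ)) ∂P = 0 := by
  have hmap : ∫ ω, Complex.exp (Complex.I * (X ω : ℂ)) ∂P
      = ∫ x : ℝ, Complex.exp (Complex.I * (x : ℂ)) ∂(P.map X) :=
    (integral_map (f := fun x : ℝ => Complex.exp (Complex.I * (x : ℂ))) hX.aemeasurable
      (by fun_prop)).symm
  have hint : ∫ x in Set.Icc 0 (2 * Real.pi), Complex.exp (Complex.I * (x : ℂ)) = 0 := by
    rw [integral_Icc_eq_integral_Ioc, ← intervalIntegral.integral_of_le Real.two_pi_pos.le,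
      integral_exp_mul_complex Complex.I_ne_zero]
    simp [mul_comm Complex.I]
  rw [hmap, h, ProbabilityTheory.cond, integral_smul_measure, hint, smul_zero]

namespace MIMORadar

variable {S : MIMORadar} {gamma Phi : Fin S.N → Ω → ℝ}

/-- The random coefficient of one tone. -/
noncomputable def toneCoeff {Ω : Type*} (gamma Phi : Fin S.N → Ω → ℝ) (i : Fin S.N) (ω : Ω) : ℂ :=
  (gamma i ω : ℂ) * Complex.exp (Complex.I * (Phi i ω : ℂ))

theorem norm_toneCoeff {Ω : Type*} {gamma Phi : Fin S.N → Ω → ℝ} (i : Fin S.N) (ω : Ω) : ‖toneCoeff gamma Phi i ω‖ = |gamma i ω| := by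
  rw [toneCoeff, norm_mul, mul_comm Complex.I, Complex.norm_exp_ofReal_mul_I, mul_one,
    Complex.norm_real, Real.norm_eq_abs]

namespace IsSelection

theorem measurable_toneCoeff (h : S.IsSelection P gamma Phi) (i : Fin S.N) : Measurable (toneCoeff gamma Phi i) := by
  have h1 := h.measurable_gamma i
  have h2 := h.measurable_Phi i
  unfold toneCoeff
  fun_prop

theorem iIndepFun_toneCoeff [IsProbabilityMeasure P] (h : S.IsSelection P gamma Phi) :
    iIndepFun (toneCoeff gamma Phi) P :=
  iIndepFun_comp_pair h.measurable_gamma h.measurable_Phi h.indep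
    (g := fun x y => (x : ℂ) * Complex.exp (Complex.I * (y : ℂ)))
    (by fun_prop)

theorem ae_norm_toneCoeff_le_one (h : S.IsSelection P gamma Phi) (i : Fin S.N) : ∀ᵐ ω ∂P, ‖toneCoeff gamma Phi i ω‖ ≤ 1 := by
  have hae : ∀ᵐ x ∂(P.map (gamma i)), |x| ≤ 1 := by
    rw [h.law_gamma, bernoulliMeasure_def, ae_add_measure_iff]
    constructor <;> refine Measure.ae_smul_measure ?_ _ <;> rw [ae_dirac_eq] <;> simp
  filter_upwards [ae_of_ae_map (h.measurable_gamma i).aemeasurable hae] with ω hω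
  rwa [norm_toneCoeff]

theorem integral_norm_toneCoeff_sq (h : S.IsSelection P gamma Phi) (i : Fin S.N) :
    ∫ ω, ‖toneCoeff gamma Phi i ω‖ ^ 2 ∂P = (S.Nc : ℝ) * S.NT / S.N := by
  simp only [norm_toneCoeff, sq_abs]
  rw [← integral_map (f := fun x : ℝ => x ^ 2) (h.measurable_gamma i).aemeasurable (by fun_prop),
    h.law_gamma, integral_bernoulliMeasure]
  simp

/-- The phase is independent of the indicator, and `exp (I x)` integrates to zero over a full
period. -/
theorem integral_toneCoeff (h : S.IsSelection P gamma Phi) (i : Fin S.N) : ∫ ω, toneCoeff gamma Phi i ω ∂P = 0 := by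
  have hi : IndepFun (gamma i) (Phi i) P :=
    h.indep.indepFun (i := Sum.inl i) (j := Sum.inr i) (by simp)
  have h1 := h.measurable_gamma i
  have h2 := h.measurable_Phi i
  refine ((hi.comp (φ := fun x : ℝ => (x : ℂ)) (ψ := fun y : ℝ => Complex.exp (Complex.I * (y : ℂ)))
    (by fun_prop) (by fun_prop)).integral_fun_mul_eq_mul_integral (by fun_prop)
    (by fun_prop)).trans ?_
  exact mul_eq_zero_of_right _ (integral_exp_I_mul_eq_zero_of_isUniform h2 (h.law_Phi i))

end IsSelection

end MIMORadar

end RadarProbability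

/-! ### The tail bound and its exponent. -/

section RadarTail

namespace MIMORadar

variable (S : MIMORadar)

theorem one_lt_totalDim : 1 < S.totalDim := by
  have hR : (1 : ℝ) ≤ S.NR := by exact_mod_cast S.NR_pos
  have hM : (1 : ℝ) ≤ S.M := by exact_mod_cast S.M_pos
  have hT : (1 : ℝ) ≤ S.NT := by exact_mod_cast S.NT_pos
  have hN : (1 : ℝ) ≤ S.N := by exact_mod_cast S.N_pos
  have h1 := one_le_mul_of_one_le_of_one_le hR hM
  have h2 := one_le_mul_of_one_le_of_one_le (one_le_mul_of_one_le_of_one_le hR hT) hN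
  rw [totalDim]
  linarith

theorem log_totalDim_pos : 0 < Real.log S.totalDim := Real.log_pos S.one_lt_totalDim

theorem NT_mul_Nc_pos : (0 : ℝ) < (S.NT : ℝ) * S.Nc :=
  mul_pos (by exact_mod_cast S.NT_pos) (by exact_mod_cast S.Nc_pos)

variable {Ω : Type*} [MeasurableSpace Ω] {P : Measure Ω} [IsProbabilityMeasure P]
  {gamma Phi : Fin S.N → Ω → ℝ}

/-- With `v = NT N / M` and `t = 2 √(v log d)`, one has `v + L t / 3 = 2 v / alpha` and `t ^ 2 / 2 =
2 v log d`, so Bernstein gives `d * exp (-alpha log d)`. -/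
theorem measureReal_le_norm_randomMatrix (h : S.IsSelection P gamma Phi) :
    P.real {ω | 2 * Real.sqrt ((S.NT : ℝ) * S.N / S.M * Real.log S.totalDim)
      ≤ ‖S.randomMatrix gamma Phi ω‖} ≤ (1 / S.totalDim) ^ (S.alpha - 1) := by
  have hM : (0 : ℝ) < S.M := by exact_mod_cast S.M_pos
  have hT : (0 : ℝ) < S.NT := by exact_mod_cast S.NT_pos
  have hN : (0 : ℝ) < S.N := by exact_mod_cast S.N_pos
  have hc : (0 : ℝ) < S.Nc := by exact_mod_cast S.Nc_pos
  have hd : 0 < S.totalDim := zero_lt_one.trans S.one_lt_totalDim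
  have hlog := S.log_totalDim_pos
  set l := Real.log S.totalDim with hl
  set v : ℝ := (S.NT : ℝ) * S.N / S.M with hv
  set L : ℝ := Real.sqrt ((S.N : ℝ) / (S.M * S.Nc)) with hL
  have hv0 : 0 < v := by positivity
  have hL0 : 0 < L := by positivity
  have : Nonempty (Fin S.Ntheta × Fin S.N) :=
    ⟨⟨⟨0, Nat.mul_pos S.NR_pos S.NT_pos⟩, ⟨0, S.N_pos⟩⟩⟩
  have hmain := Matrix.measureReal_le_norm_sum_smul_le h.measurable_toneCoeff
    h.iIndepFun_toneCoeff h.ae_norm_toneCoeff_le_one h.integral_toneCoeff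
    (q := (S.Nc : ℝ) * S.NT / S.N) (by positivity) (fun i => (h.integral_norm_toneCoeff_sq i).le)
    S.toneMatrix hL0 S.norm_toneMatrix_le hv0
    (by
      rw [hL, Real.sq_sqrt (by positivity), Fintype.card_fin, hv]
      refine le_of_eq ?_
      field_simp) (t := 2 * Real.sqrt (v * l)) (by positivity)
  refine hmain.trans_eq ?_
  have hdim : (Fintype.card (Fin S.NR × Fin S.M) : ℝ) + Fintype.card (Fin S.Ntheta × Fin S.N)
      = S.totalDim := by
    simp [totalDim]
  have hLv : L * Real.sqrt (v * l) = v * Real.sqrt (1 / ((S.NT : ℝ) * S.Nc) * l) := by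
    rw [hL, ← Real.sqrt_mul (by positivity), ← Real.sqrt_sq hv0.le, ← Real.sqrt_mul (sq_nonneg v),
      Real.sqrt_sq hv0.le]
    congr 1
    rw [hv]
    field_simp
  have hexpo : -((2 * Real.sqrt (v * l)) ^ 2 / 2) / (v + L * (2 * Real.sqrt (v * l)) / 3)
      = -(S.alpha * l) := by
    have h1 : v + L * (2 * Real.sqrt (v * l)) / 3
        = 2 * v * (1 / 3 * Real.sqrt (1 / ((S.NT : ℝ) * S.Nc) * l) + 1 / 2) := by
      rw [show L * (2 * Real.sqrt (v * l)) = 2 * (L * Real.sqrt (v * l)) by ring, hLv]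
      ring
    have h2 : 0 < 1 / 3 * Real.sqrt (1 / ((S.NT : ℝ) * S.Nc) * l) + 1 / 2 := by positivity
    rw [h1, mul_pow, Real.sq_sqrt (by positivity), alpha, ← hl]
    field_simp
  rw [hdim, hexpo, one_div, Real.inv_rpow hd.le, ← Real.rpow_neg hd.le,
    Real.rpow_def_of_pos hd, ← hl]
  nth_rewrite 1 [← Real.exp_log hd]
  rw [← Real.exp_add, ← hl]
  congr 1
  ring

/-- The two events cover the space, so subadditivity suffices and no measurability of them is
needed. -/
theorem one_sub_le_measureReal_norm_randomMatrix_le (h : S.IsSelection P gamma Phi) :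
    1 - (1 / S.totalDim) ^ (S.alpha - 1) ≤
      P.real {ω | ‖S.randomMatrix gamma Phi ω‖
        ≤ 2 * Real.sqrt ((S.NT : ℝ) * S.N / S.M * Real.log S.totalDim)} := by
  have h1 := S.measureReal_le_norm_randomMatrix h
  have h2 := measureReal_union_le (μ := P)
    {ω | ‖S.randomMatrix gamma Phi ω‖
      ≤ 2 * Real.sqrt ((S.NT : ℝ) * S.N / S.M * Real.log S.totalDim)}
    {ω | 2 * Real.sqrt ((S.NT : ℝ) * S.N / S.M * Real.log S.totalDim)
      ≤ ‖S.randomMatrix gamma Phi ω‖}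
  have h3 : {ω | ‖S.randomMatrix gamma Phi ω‖
      ≤ 2 * Real.sqrt ((S.NT : ℝ) * S.N / S.M * Real.log S.totalDim)} ∪
    {ω | 2 * Real.sqrt ((S.NT : ℝ) * S.N / S.M * Real.log S.totalDim)
      ≤ ‖S.randomMatrix gamma Phi ω‖} = Set.univ := by
    ext ω
    simpa using le_total _ _
  rw [h3, probReal_univ] at h2
  linarith

/-- The constant comes from `√u / 3 + 1 / 2 < 1 ↔ u < 9 / 4`, with `u = log d / (NT Nc)`. -/
theorem one_lt_alpha_iff :
    1 < S.alpha ↔ 4 / 9 * Real.log S.totalDim < (S.Nc : ℝ) * S.NT := by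
  have hlog := S.log_totalDim_pos
  have hTc := S.NT_mul_Nc_pos
  have hden : 0 < 1 / 3 * Real.sqrt (1 / ((S.NT : ℝ) * S.Nc) * Real.log S.totalDim) + 1 / 2 := by
    positivity
  rw [alpha, lt_div_iff₀ hden, one_mul]
  have h1 : 1 / 3 * Real.sqrt (1 / ((S.NT : ℝ) * S.Nc) * Real.log S.totalDim) + 1 / 2 < 1
      ↔ Real.sqrt (1 / ((S.NT : ℝ) * S.Nc) * Real.log S.totalDim) < 3 / 2 := by
    constructor <;> intro h <;> linarith
  rw [h1, Real.sqrt_lt' (by norm_num), one_div_mul_eq_div, div_lt_iff₀ hTc, mul_comm (S.Nc : ℝ)]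
  constructor <;> intro h <;> linarith

theorem le_alpha_of_mul_log_le {kappa : ℝ} (hk : 0 < kappa)
    (h : kappa * Real.log S.totalDim ≤ (S.Nc : ℝ) * S.NT) :
    1 / (1 / 3 * Real.sqrt (1 / kappa) + 1 / 2) ≤ S.alpha := by
  have hlog := S.log_totalDim_pos
  have hTc := S.NT_mul_Nc_pos
  rw [alpha]
  gcongr
  rw [one_div_mul_eq_div, div_le_div_iff₀ hTc hk]
  linarith

end MIMORadar

end RadarTail

theorem mainTheorem3 :
    -- the tail bound, for every system
    (∀ (S : MIMORadar) {Ω : Type*} [MeasurableSpace Ω] (P : Measure Ω) [IsProbabilityMeasure P]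
        (gamma Phi : Fin S.N → Ω → ℝ), S.IsSelection P gamma Phi →
      P.real {ω | 2 * Real.sqrt ((S.NT : ℝ) * S.N / S.M * Real.log S.totalDim)
          ≤ ‖S.randomMatrix gamma Phi ω‖} ≤ (1 / S.totalDim) ^ (S.alpha - 1) ∧
      1 - (1 / S.totalDim) ^ (S.alpha - 1) ≤
        P.real {ω | ‖S.randomMatrix gamma Phi ω‖
          ≤ 2 * Real.sqrt ((S.NT : ℝ) * S.N / S.M * Real.log S.totalDim)}) ∧
    -- when the exponent of the tail bound is a decaying one
    (∀ S : MIMORadar,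
      1 < S.alpha ↔ 4 / 9 * Real.log S.totalDim < (S.Nc : ℝ) * S.NT) ∧
    -- hence the bound holds with high probability, uniformly over all large systems
    (∀ kappa : ℝ, 4 / 9 < kappa → ∀ ε : ℝ, 0 < ε → ∃ d₀ : ℝ, ∀ S : MIMORadar,
      d₀ ≤ S.totalDim → kappa * Real.log S.totalDim ≤ (S.Nc : ℝ) * S.NT →
      ∀ {Ω : Type*} [MeasurableSpace Ω] (P : Measure Ω) [IsProbabilityMeasure P]
        (gamma Phi : Fin S.N → Ω → ℝ), S.IsSelection P gamma Phi →
      1 - ε ≤ P.real {ω | ‖S.randomMatrix gamma Phi ω‖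
        ≤ 2 * Real.sqrt ((S.NT : ℝ) * S.N / S.M * Real.log S.totalDim)}) := by
  refine ⟨fun S Ω _ P _ gamma Phi h => ⟨S.measureReal_le_norm_randomMatrix h,
    S.one_sub_le_measureReal_norm_randomMatrix_le h⟩, fun S => S.one_lt_alpha_iff, ?_⟩
  intro kappa hk ε hε
  have hk0 : 0 < kappa := by linarith
  have hsqrt : Real.sqrt (1 / kappa) < 3 / 2 := by
    rw [Real.sqrt_lt' (by norm_num), div_lt_iff₀ hk0]
    linarith
  -- The margin of `alpha` over `1` guaranteed by `kappa` alone. The failure probability is at most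
  -- `d ^ (-β)`, uniformly over the systems considered.
  set β : ℝ := 1 / (1 / 3 * Real.sqrt (1 / kappa) + 1 / 2) - 1 with hβ
  have hβ0 : 0 < β := by
    rw [hβ, sub_pos, lt_div_iff₀ (by positivity)]
    linarith
  obtain ⟨d₀, hd₀⟩ := Filter.eventually_atTop.mp
    ((tendsto_rpow_neg_atTop hβ0).eventually_le_const hε)
  refine ⟨d₀, fun S hS hSk Ω _ P _ gamma Phi h => ?_⟩
  have hd1 := S.one_lt_totalDim
  have hd : 0 < S.totalDim := zero_lt_one.trans hd1
  have hα := S.le_alpha_of_mul_log_le hk0 hSk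
  refine le_trans ?_ (S.one_sub_le_measureReal_norm_randomMatrix_le h)
  have hpow : (1 / S.totalDim) ^ (S.alpha - 1) ≤ S.totalDim ^ (-β) := by
    rw [one_div, Real.inv_rpow hd.le, ← Real.rpow_neg hd.le]
    exact Real.rpow_le_rpow_of_exponent_le hd1.le (by linarith)
  linarith [hd₀ S.totalDim hS]
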